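/- Let $n\ge 0$, $\mathcal H=(\mathbb C^2)^{\otimes n}$, and let $\mathcal P_n$ be the set of the $4^n$ Pauli strings on $n$ qubits (tensor products of $\mathbb 1,X,Y,Z$). A subgroup $G\subseteq\mathbb U(\mathcal H)$ is called \emph{Pauli-compatible} if (i) for some $\mathcal S_0\subseteq\mathcal P_n$ it consists exactly of the finite products $\prod_j e^{i\theta_jP_j}$ with $\theta_j\in\mathbb R$, $P_j\in\mathcal S_0$, and (ii) the space $\{A\in\mathcal L(\mathcal H): UAU^\dagger=A\ \forall U\in G\}$ is the complex span of a set of Pauli strings. $G$ \emph{preserves a bilinear form} if there is a non-zero $\Omega\in\mathcal L(\mathcal H)$ with $U^{\mathsf T}\Omega U=\Omega$ for all $U\in G$ (transpose in the computational basis). For $\mathcal S\subseteq\mathcal P_n$, the \emph{commutator graph} $\mathcal G_{\mathcal S}$ has vertex set $\mathcal P_n$, and $P,Q$ are adjacent iff there are $H\in\mathcal S$ and $c\in\mathbb C\setminus\{0\}$ with $[H,P]=cQ$. Let $\mathcal N_{N,\mathcal S}(P)$ be the set of vertices at graph distance at most $N$ from $P$, and $\mathcal N_{\mathcal S}(P)$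 the connected component of $P$. For a probability measure $\nu$ on $\mathbb U(\mathcal H)$ let $\phi^{(2)}_\nu(X)=\mathbb E_{U\sim\nu}\big[U^{\otimes 2}X(U^\dagger)^{\otimes 2}\big]$ be its second moment channel on $\mathcal L(\mathcal H^{\otimes 2})$, and let $\|\phi\|_\diamond=\sup_{m,\rho}\|(\phi\otimes\mathcal I_m)(\rho)\|_1$, where the supremum is over all ancilla dimensions $m$ and all density matrices $\rho$ on $\mathcal H^{\otimes 2}\otimes\mathbb C^m$. \textbf{Theorem.} Let $G$ be a Pauli-compatible group that preserves a bilinear form, with normalized Haar measure $\mu_G$, and let $\mathcal S\subseteq\mathcal P_n$ be a set of Pauli strings in the Lie algebra of $G$, i.e. $e^{itH}\in G$ for all $H\in\mathcal S$, $t\in\mathbb R$ (for example a set $\mathcal S$ of Pauli strings that generates $G$ as in (i)). Let $N\ge 0$ and let $\mathcal E_N^{\mathcal S}$ be any ensemble (probability measure on $\mathbb U(\mathcal H)$) that is almost surely of the form $U=\prod_{\ell=1}^N\exp(i\vartheta_\ell H_\ell)$ with $\vartheta_\ell\in\mathbb R$ and $H_\ell\in\mathcal S$. Then for every Pauli string $P\in\mathcal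 P_n$, $$\big\|\phi^{(2)}_{\mathcal E_N^{\mathcal S}}-\phi^{(2)}_{\mu_G}\big\|_\diamond\ \ge\ 2-2\,\frac{|\mathcal N_{N,\mathcal S}(P)|}{|\mathcal N_{\mathcal S}(P)|}.$$ -/

import Mathlib

open scoped Matrix Kronecker ComplexOrder ENNReal
open MeasureTheory

namespace PauliDesign

noncomputable section

/-! ### Qubits, Pauli strings, unitaries -/

/-- Labels of the computational basis of `(ℂ²)^{⊗ n}`. -/
abbrev Bits (n : ℕ) : Type := Fin n → Fin 2

/-- Operators on `(ℂ²)^{⊗ n}`, as matrices in the computational basis. -/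
abbrev Op (n : ℕ) : Type := Matrix (Bits n) (Bits n) ℂ

/-- The unitary group of `(ℂ²)^{⊗ n}`. -/
abbrev UGroup (n : ℕ) : Type := Matrix.unitaryGroup (Bits n) ℂ

/-- The unitary group carries its Borel σ-algebra. -/
instance instMeasurableSpaceUGroup (n : ℕ) : MeasurableSpace (UGroup n) := borel _

instance instBorelSpaceUGroup (n : ℕ) : BorelSpace (UGroup n) := ⟨rfl⟩

/-- The four single-qubit Pauli matrices `1, X, Y, Z`. -/
def sigma : Fin 4 → Matrix (Fin 2) (Fin 2) ℂ :=
  ![1, !![0, 1; 1, 0], !![0, -Complex.I; Complex.I, 0], !![1, 0; 0, -1]]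

/-- The `4 ^ n` Pauli strings on `n` qubits. -/
abbrev PauliString (n : ℕ) : Type := Fin n → Fin 4

/-- The operator of a Pauli string, the tensor product of its single-qubit factors. -/
def pauliOp {n : ℕ} (P : PauliString n) : Op n :=
  Matrix.of fun a b => ∏ i, sigma (P i) (a i) (b i)

theorem sigma_mul_self (a : Fin 4) : sigma a * sigma a = 1 := by
  fin_cases a <;> ext i j <;> fin_cases i <;> fin_cases j <;>
    simp [sigma, Matrix.mul_apply, Fin.sum_univ_two]

theorem sigma_comm_or (a b : Fin 4) :
    ∃ s : ℂ, s * s = 1 ∧ sigma a * sigma b = s • (sigma b * sigma a) := by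
  by_cases h : a = 0 ∨ b = 0 ∨ a = b
  · refine ⟨1, by norm_num, ?_⟩
    rcases h with h | h | h <;> subst h <;> simp [sigma]
  · refine ⟨-1, by norm_num, ?_⟩
    fin_cases a <;> fin_cases b <;> simp at h <;>
      ext i j <;> fin_cases i <;> fin_cases j <;>
      simp [sigma, Matrix.mul_apply, Fin.sum_univ_two]

theorem pauliOp_mul_apply {n : ℕ} (P Q : PauliString n) (a b : Bits n) :
    (pauliOp P * pauliOp Q) a b = ∏ i, (sigma (P i) * sigma (Q i)) (a i) (b i) := by
  simp only [Matrix.mul_apply, pauliOp, Matrix.of_apply]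
  rw [Finset.prod_univ_sum, Fintype.piFinset_univ]
  exact Finset.sum_congr rfl fun c _ => (Finset.prod_mul_distrib).symm

theorem pauliOp_mul_self {n : ℕ} (P : PauliString n) : pauliOp P * pauliOp P = 1 := by
  ext a b
  rw [pauliOp_mul_apply]
  simp only [sigma_mul_self, Matrix.one_apply]
  by_cases h : a = b
  · simp [h]
  · rw [if_neg h]
    obtain ⟨i, hi⟩ := Function.ne_iff.mp h
    exact Finset.prod_eq_zero (Finset.mem_univ i) (if_neg hi)

theorem pauliOp_comm_or {n : ℕ} (P Q : PauliString n) :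
    ∃ s : ℂ, s * s = 1 ∧ pauliOp P * pauliOp Q = s • (pauliOp Q * pauliOp P) := by
  choose s hs hs' using fun i => sigma_comm_or (P i) (Q i)
  refine ⟨∏ i, s i, ?_, ?_⟩
  · rw [← Finset.prod_mul_distrib]
    exact Finset.prod_eq_one fun i _ => hs i
  · ext a b
    rw [Matrix.smul_apply, pauliOp_mul_apply, pauliOp_mul_apply, smul_eq_mul,
      ← Finset.prod_mul_distrib]
    exact Finset.prod_congr rfl fun i _ => by rw [hs' i, Matrix.smul_apply, smul_eq_mul]

/-- Whether some `H ∈ S` satisfies `[H, P] ∝ Q` with a nonzero constant. -/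
def CommutatorAdj {n : ℕ} (S : Set (PauliString n)) (P Q : PauliString n) : Prop :=
  ∃ H ∈ S, ∃ c : ℂ, c ≠ 0 ∧ pauliOp H * pauliOp P - pauliOp P * pauliOp H = c • pauliOp Q

theorem CommutatorAdj.symm {n : ℕ} {S : Set (PauliString n)} {P Q : PauliString n}
    (h : CommutatorAdj S P Q) : CommutatorAdj S Q P := by
  obtain ⟨H, hH, c, hc, h⟩ := h
  obtain ⟨s, hs, hs'⟩ := pauliOp_comm_or P H
  have h2 := pauliOp_mul_self H
  have hHPH : pauliOp H * (pauliOp P * pauliOp H) = s • pauliOp P := by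
    rw [hs', Matrix.mul_smul, ← Matrix.mul_assoc, h2, Matrix.one_mul]
  have hPHH : pauliOp P * pauliOp H * pauliOp H = pauliOp P := by
    rw [Matrix.mul_assoc, h2, Matrix.mul_one]
  have key : c • (pauliOp H * pauliOp Q - pauliOp Q * pauliOp H)
      = (2 * (1 - s)) • pauliOp P := by
    rw [smul_sub, ← Matrix.mul_smul, ← Matrix.smul_mul, ← h, Matrix.mul_sub, Matrix.sub_mul,
      ← Matrix.mul_assoc, h2, Matrix.one_mul, hPHH, Matrix.mul_assoc, hHPH]
    module
  have hs1 : s ≠ 1 := by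
    rintro rfl
    rw [hs', one_smul, sub_self] at h
    have h0 : pauliOp Q = 0 := (smul_eq_zero.mp h.symm).resolve_left hc
    have h1 := pauliOp_mul_self Q
    rw [h0, Matrix.zero_mul] at h1
    exact zero_ne_one h1
  refine ⟨H, hH, c⁻¹ * (2 * (1 - s)), ?_, ?_⟩
  · exact mul_ne_zero (inv_ne_zero hc) (mul_ne_zero two_ne_zero (sub_ne_zero.mpr hs1.symm))
  · rw [mul_smul, ← key, smul_smul, inv_mul_cancel₀ hc, one_smul]

theorem CommutatorAdj.irrefl {n : ℕ} {S : Set (PauliString n)} {P : PauliString n} :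
    ¬ CommutatorAdj S P P := by
  rintro ⟨H, -, c, hc, h⟩
  have h2 := pauliOp_mul_self P
  have h3 := congrArg (fun A => (A * pauliOp P).trace) h
  simp only [Matrix.sub_mul, Matrix.smul_mul, h2, Matrix.trace_sub, Matrix.trace_smul,
    Matrix.trace_one] at h3
  rw [Matrix.mul_assoc, h2, Matrix.mul_assoc, Matrix.trace_mul_comm (pauliOp P),
    Matrix.mul_assoc, h2, sub_self, smul_eq_mul] at h3
  exact mul_ne_zero hc (Nat.cast_ne_zero.mpr Fintype.card_ne_zero) h3.symm

/-- The commutator graph of `S`. -/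
def commutatorGraph {n : ℕ} (S : Set (PauliString n)) : SimpleGraph (PauliString n) where
  Adj := CommutatorAdj S
  symm := ⟨fun _ _ h => h.symm⟩
  loopless := ⟨fun _ => CommutatorAdj.irrefl⟩

/-- The Pauli strings at distance at most `N` from `P` in the commutator graph of `S`
(`edist` is infinite between different connected components). -/
def pauliBall {n : ℕ} (S : Set (PauliString n)) (N : ℕ) (P : PauliString n) :
    Set (PauliString n) :=
  {Q | (commutatorGraph S).edist P Q ≤ N}

/-- The connected component of `P` in the commutator graph of `S`. -/
def pauliComponent {n : ℕ} (S : Set (PauliString n)) (P : PauliString n) :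
    Set (PauliString n) :=
  {Q | (commutatorGraph S).Reachable P Q}

/-! ### Circuits and groups -/

/-- `U = ∏_{ℓ = 1}^N exp(i ϑ_ℓ H_ℓ)` with real `ϑ_ℓ` and Pauli strings `H_ℓ ∈ S`. -/
def IsPauliCircuit {n : ℕ} (S : Set (PauliString n)) (N : ℕ) (U : UGroup n) : Prop :=
  ∃ (θ : Fin N → ℝ) (H : Fin N → PauliString n), (∀ l, H l ∈ S) ∧
    (U : Op n) =
      (List.ofFn fun l => NormedSpace.exp ((Complex.I * (θ l : ℂ)) • pauliOp (H l))).prod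

/-- A group of unitaries is Pauli-compatible if it consists of the finite products of
`exp(i θ P)` with `P` in some set of Pauli strings, and the space of operators invariant under
it is spanned by Pauli strings. -/
def IsPauliCompatible {n : ℕ} (G : Subgroup (UGroup n)) : Prop :=
  (∃ S₀ : Set (PauliString n), ∀ U : UGroup n, U ∈ G ↔ ∃ N : ℕ, IsPauliCircuit S₀ N U) ∧
  ∃ B : Set (PauliString n), ∀ A : Op n,
    (∀ U ∈ G, (U : Op n) * A * (U : Op n)ᴴ = A) ↔ A ∈ Submodule.span ℂ (pauliOp '' B)

/-- `G` preserves a nonzero bilinear form. -/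
def PreservesBilinearForm {n : ℕ} (G : Subgroup (UGroup n)) : Prop :=
  ∃ Ω : Op n, Ω ≠ 0 ∧ ∀ U ∈ G, (U : Op n)ᵀ * Ω * (U : Op n) = Ω

/-- The Lie algebra of `G`: the operators `X` with `exp(t X) ∈ G` for all real `t`. -/
def lieAlgebra {n : ℕ} (G : Subgroup (UGroup n)) : Set (Op n) :=
  {X | ∀ t : ℝ, ∃ U ∈ G, (U : Op n) = NormedSpace.exp ((t : ℂ) • X)}

/-! ### Second moment channels -/

theorem continuous_twirl {n : ℕ} (X : Matrix (Bits n × Bits n) (Bits n × Bits n) ℂ)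
    (a b : Bits n × Bits n) :
    Continuous fun U : UGroup n =>
      (((U : Op n) ⊗ₖ (U : Op n)) * X * ((U : Op n) ⊗ₖ (U : Op n))ᴴ) a b := by
  have h : ∀ i j : Bits n, Continuous fun U : UGroup n => (U : Op n) i j := fun i j =>
    (continuous_apply_apply (ρ := fun _ _ => ℂ) i j).comp continuous_subtype_val
  simp only [Matrix.mul_apply, Matrix.kroneckerMap_apply, Matrix.conjTranspose_apply]
  refine continuous_finsetSum _ fun c _ => Continuous.mul ?_ ?_
  · exact continuous_finsetSum _ fun d _ =>
      ((h _ _).mul (h _ _)).mul continuous_const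
  · exact ((h _ _).mul (h _ _)).star

theorem integrable_twirl {n : ℕ} (ν : Measure (UGroup n)) [IsFiniteMeasure ν]
    (X : Matrix (Bits n × Bits n) (Bits n × Bits n) ℂ) (a b : Bits n × Bits n) :
    Integrable (fun U : UGroup n =>
      (((U : Op n) ⊗ₖ (U : Op n)) * X * ((U : Op n) ⊗ₖ (U : Op n))ᴴ) a b) ν := by
  have hent : ∀ (U : UGroup n) (i j : Bits n), ‖(U : Op n) i j‖ ≤ 1 := fun U i j =>
    entry_norm_bound_of_unitary U.2 i j
  have hk : ∀ (U : UGroup n) (i j : Bits n × Bits n),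
      ‖((U : Op n) ⊗ₖ (U : Op n)) i j‖ ≤ 1 := fun U i j => by
    rw [Matrix.kroneckerMap_apply, norm_mul]
    exact mul_le_one₀ (hent _ _ _) (norm_nonneg _) (hent _ _ _)
  refine Integrable.of_bound (continuous_twirl X a b).aestronglyMeasurable
    (∑ c, ∑ d, ‖X d c‖) (Filter.Eventually.of_forall fun U => ?_)
  rw [Matrix.mul_apply]
  refine (norm_sum_le _ _).trans (Finset.sum_le_sum fun c _ => ?_)
  rw [norm_mul, Matrix.conjTranspose_apply, norm_star, Matrix.mul_apply]
  refine (mul_le_of_le_one_right (norm_nonneg _) (hk U _ _)).trans ?_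
  refine (norm_sum_le _ _).trans (Finset.sum_le_sum fun d _ => ?_)
  rw [norm_mul]
  exact mul_le_of_le_one_left (norm_nonneg _) (hk U _ _)

/-- The second moment channel `X ↦ 𝔼_{U ∼ ν} U^{⊗ 2} X (U^†)^{⊗ 2}` of an ensemble `ν`
(the expectation is taken entry by entry). -/
def momentChannel {n : ℕ} (ν : Measure (UGroup n)) [IsFiniteMeasure ν] :
    Matrix (Bits n × Bits n) (Bits n × Bits n) ℂ →ₗ[ℂ]
      Matrix (Bits n × Bits n) (Bits n × Bits n) ℂ where
  toFun X := Matrix.of fun a b =>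
    ∫ U : UGroup n, (((U : Op n) ⊗ₖ (U : Op n)) * X * ((U : Op n) ⊗ₖ (U : Op n))ᴴ) a b ∂ν
  map_add' X Y := by
    ext a b
    simp only [Matrix.mul_add, Matrix.add_mul, Matrix.add_apply, Matrix.of_apply]
    exact integral_add (integrable_twirl ν X a b) (integrable_twirl ν Y a b)
  map_smul' c X := by
    ext a b
    simp only [Matrix.mul_smul, Matrix.smul_mul, Matrix.smul_apply, Matrix.of_apply,
      RingHom.id_apply]
    exact integral_smul c _

/-! ### Trace norm and diamond norm -/

/-- The trace norm: the sum of the singular values, i.e. of the square roots of the eigenvalues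
of `Aᴴ A`. -/
def traceNorm {ι : Type*} [Fintype ι] [DecidableEq ι] (A : Matrix ι ι ℂ) : ℝ :=
  ∑ i, √((Matrix.isHermitian_conjTranspose_mul_self A).eigenvalues i)

/-- Quantum states (density matrices). -/
def IsState {ι : Type*} [Fintype ι] (ρ : Matrix ι ι ℂ) : Prop :=
  ρ.PosSemidef ∧ ρ.trace = 1

/-- `φ ⊗ id` acting on operators on `ℂ^ι ⊗ ℂ^m`: `φ` is applied to each block
`(1 ⊗ ⟨k|) ρ (1 ⊗ |l⟩)`. -/
def withAncilla {ι : Type*} (φ : Matrix ι ι ℂ →ₗ[ℂ] Matrix ι ι ℂ) (m : ℕ)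
    (ρ : Matrix (ι × Fin m) (ι × Fin m) ℂ) : Matrix (ι × Fin m) (ι × Fin m) ℂ :=
  Matrix.of fun x y => φ (Matrix.of fun i j => ρ (i, x.2) (j, y.2)) x.1 y.1

/-- The diamond norm: the supremum of `‖(φ ⊗ id) ρ‖₁` over all ancilla dimensions `m` and all
states `ρ` of system plus ancilla. -/
def diamondNorm {ι : Type*} [Fintype ι] [DecidableEq ι]
    (φ : Matrix ι ι ℂ →ₗ[ℂ] Matrix ι ι ℂ) : ℝ≥0∞ :=
  ⨆ (m : ℕ) (ρ : Matrix (ι × Fin m) (ι × Fin m) ℂ) (_ : IsState ρ),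
    ENNReal.ofReal (traceNorm (withAncilla φ m ρ))

end

end PauliDesign

open PauliDesign

/-! A state and a measurement are exhibited that tell the circuit ensemble from the Haar measure.
For H in a generating set of `G`, the rotation by π/2 puts iH in `G`, so an invariant form Ω
satisfies Hᵀ Ω H = -Ω. Since H K Hᵀ = ±K for every Pauli string K, any K with tr(K Ω) ≠ 0 must have
H K Hᵀ = -K, and then U K Uᵀ = K on all of `G` (`exists_pauliOp_invariant`).

The vectors vec(Q K), with Q ranging over the Pauli strings, form an orthogonal basis of the doubled
space. Invariance of K gives (U ⊗ U) vec(P K) = vec(U P U† K). Hence preparing the normalized vec(P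
K), applying U ⊗ U and measuring in this basis yields Q with probability `pauliWeight P Q U`, the
squared Pauli coefficient of U P U† (`trace_bellProj_mul_twirl`).

Each rotation moves a Pauli string at most one step in the commutator graph, so after N gates the
outcome lies in the ball of radius N (`trace_circuit_eq_zero`). Rotations by π/4 exchange adjacent
strings up to sign, so by invariance of the Haar measure its outcome probabilities are constant on
the component of P, hence at most 1 over its size. The reflection 2Π - 1, with Π the projection onto
the ball, has expectation 1 for circuits and at most 2 |ball| / |component| - 1 for Haar; since it
is unitary, the difference bounds the diamond norm from below. -/

namespace PauliDesign

/-! ### Algebra of Pauli strings -/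

theorem sigma_conjTranspose (a : Fin 4) : (sigma a)ᴴ = sigma a := by
  fin_cases a <;> ext i j <;> fin_cases i <;> fin_cases j <;>
    simp [sigma, Matrix.conjTranspose_apply]

theorem sigma_transpose (a : Fin 4) : ∃ s : ℂ, s * s = 1 ∧ (sigma a)ᵀ = s • sigma a := by
  by_cases h : a = 2
  · refine ⟨-1, by norm_num, ?_⟩
    subst h
    ext i j; fin_cases i <;> fin_cases j <;> simp [sigma]
  · refine ⟨1, by norm_num, ?_⟩
    fin_cases a <;> simp at h <;>
      ext i j <;> fin_cases i <;> fin_cases j <;> simp [sigma]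

theorem sigma_mul (a b : Fin 4) :
    ∃ (c : Fin 4) (s : ℂ), s ≠ 0 ∧ sigma a * sigma b = s • sigma c := by
  have h0 : sigma 0 = 1 := rfl
  have h12 : sigma 1 * sigma 2 = Complex.I • sigma 3 := by
    ext i j; fin_cases i <;> fin_cases j <;> simp [sigma, Matrix.mul_apply, Fin.sum_univ_two]
  have h23 : sigma 2 * sigma 3 = Complex.I • sigma 1 := by
    ext i j; fin_cases i <;> fin_cases j <;> simp [sigma, Matrix.mul_apply, Fin.sum_univ_two]
  have h31 : sigma 3 * sigma 1 = Complex.I • sigma 2 := by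
    ext i j; fin_cases i <;> fin_cases j <;> simp [sigma, Matrix.mul_apply, Fin.sum_univ_two]
  have h21 : sigma 2 * sigma 1 = (-Complex.I) • sigma 3 := by
    ext i j; fin_cases i <;> fin_cases j <;> simp [sigma, Matrix.mul_apply, Fin.sum_univ_two]
  have h32 : sigma 3 * sigma 2 = (-Complex.I) • sigma 1 := by
    ext i j; fin_cases i <;> fin_cases j <;> simp [sigma, Matrix.mul_apply, Fin.sum_univ_two]
  have h13 : sigma 1 * sigma 3 = (-Complex.I) • sigma 2 := by
    ext i j; fin_cases i <;> fin_cases j <;> simp [sigma, Matrix.mul_apply, Fin.sum_univ_two]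
  have hI : -Complex.I ≠ 0 := neg_ne_zero.mpr Complex.I_ne_zero
  by_cases ha : a = 0
  · exact ⟨b, 1, one_ne_zero, by rw [ha, h0, one_mul, one_smul]⟩
  by_cases hb : b = 0
  · exact ⟨a, 1, one_ne_zero, by rw [hb, h0, mul_one, one_smul]⟩
  by_cases hab : a = b
  · exact ⟨0, 1, one_ne_zero, by rw [hab, sigma_mul_self, h0, one_smul]⟩
  fin_cases a <;> fin_cases b <;> simp at ha hb hab
  · exact ⟨3, _, Complex.I_ne_zero, h12⟩
  · exact ⟨2, _, hI, h13⟩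
  · exact ⟨3, _, hI, h21⟩
  · exact ⟨1, _, Complex.I_ne_zero, h23⟩
  · exact ⟨2, _, Complex.I_ne_zero, h31⟩
  · exact ⟨1, _, hI, h32⟩

theorem sigma_trace_mul (a b : Fin 4) (h : a ≠ b) : (sigma a * sigma b).trace = 0 := by
  fin_cases a <;> fin_cases b <;> simp at h <;>
    simp [sigma, Matrix.trace, Fin.sum_univ_two]

/-- The sum of σ ⊗ σ over the four Pauli matrices is twice the swap; this is the source of the Pauli
expansion of an operator. -/
theorem sigma_completeness (i j k l : Fin 2) :
    ∑ a, sigma a i j * sigma a k l = if i = l ∧ j = k then 2 else 0 := by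
  fin_cases i <;> fin_cases j <;> fin_cases k <;> fin_cases l <;>
    simp [sigma, Fin.sum_univ_four] <;> norm_num

variable {n : ℕ}

theorem pauliOp_conjTranspose (P : PauliString n) : (pauliOp P)ᴴ = pauliOp P := by
  ext a b
  simp only [Matrix.conjTranspose_apply, pauliOp, Matrix.of_apply, star_prod]
  refine Finset.prod_congr rfl fun i _ => ?_
  rw [← Matrix.conjTranspose_apply, sigma_conjTranspose]

theorem pauliOp_transpose (P : PauliString n) :
    ∃ s : ℂ, s * s = 1 ∧ (pauliOp P)ᵀ = s • pauliOp P := by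
  choose s hs hs' using fun i => sigma_transpose (P i)
  refine ⟨∏ i, s i, ?_, ?_⟩
  · rw [← Finset.prod_mul_distrib]
    exact Finset.prod_eq_one fun i _ => hs i
  · ext a b
    simp only [Matrix.transpose_apply, Matrix.smul_apply, pauliOp, Matrix.of_apply, smul_eq_mul]
    rw [← Finset.prod_mul_distrib]
    refine Finset.prod_congr rfl fun i _ => ?_
    rw [← Matrix.transpose_apply (sigma (P i)), hs' i, Matrix.smul_apply, smul_eq_mul]

theorem pauliOp_mul (P Q : PauliString n) :
    ∃ (R : PauliString n) (s : ℂ), s ≠ 0 ∧ pauliOp P * pauliOp Q = s • pauliOp R := by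
  choose R s hs hs' using fun i => sigma_mul (P i) (Q i)
  refine ⟨R, ∏ i, s i, Finset.prod_ne_zero_iff.mpr fun i _ => hs i, ?_⟩
  ext a b
  rw [pauliOp_mul_apply, Matrix.smul_apply, smul_eq_mul, pauliOp, Matrix.of_apply,
    ← Finset.prod_mul_distrib]
  exact Finset.prod_congr rfl fun i _ => by rw [hs' i, Matrix.smul_apply, smul_eq_mul]

theorem pauliOp_trace_mul {P Q : PauliString n} (h : P ≠ Q) :
    (pauliOp P * pauliOp Q).trace = 0 := by
  obtain ⟨i, hi⟩ := Function.ne_iff.mp h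
  have : (pauliOp P * pauliOp Q).trace = ∏ i, (sigma (P i) * sigma (Q i)).trace := by
    simp only [Matrix.trace, Matrix.diag_apply, pauliOp_mul_apply]
    rw [Finset.prod_univ_sum, Fintype.piFinset_univ]
  rw [this]
  exact Finset.prod_eq_zero (Finset.mem_univ i) (sigma_trace_mul _ _ hi)

theorem pauliOp_trace_mul_self (P : PauliString n) : (pauliOp P * pauliOp P).trace = 2 ^ n := by
  simp [pauliOp_mul_self]

theorem pauliOp_completeness (a b c d : Bits n) :
    ∑ Q : PauliString n, pauliOp Q a b * pauliOp Q c d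
      = if a = d ∧ b = c then 2 ^ n else 0 := by
  have h : ∑ Q : PauliString n, pauliOp Q a b * pauliOp Q c d
      = ∏ i, ∑ k, sigma k (a i) (b i) * sigma k (c i) (d i) := by
    rw [Finset.prod_univ_sum, Fintype.piFinset_univ]
    simp only [pauliOp, Matrix.of_apply, Finset.prod_mul_distrib]
  rw [h]
  simp only [sigma_completeness]
  by_cases had : a = d
  · by_cases hbc : b = c
    · simp [had, hbc]
    · obtain ⟨i, hi⟩ := Function.ne_iff.mp hbc
      rw [if_neg (fun h => hbc h.2)]
      exact Finset.prod_eq_zero (Finset.mem_univ i) (if_neg fun h => hi h.2)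
  · obtain ⟨i, hi⟩ := Function.ne_iff.mp had
    rw [if_neg (fun h => had h.1)]
    exact Finset.prod_eq_zero (Finset.mem_univ i) (if_neg fun h => hi h.1)

/-- The expansion of an operator in the basis of Pauli strings. -/
theorem sum_trace_smul_pauliOp (A : Op n) :
    ∑ Q : PauliString n, (pauliOp Q * A).trace • pauliOp Q = (2 ^ n : ℂ) • A := by
  ext c d
  simp only [Matrix.sum_apply, Matrix.smul_apply, smul_eq_mul, Matrix.trace, Matrix.diag_apply,
    Matrix.mul_apply, Finset.sum_mul]
  rw [Finset.sum_comm]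
  calc ∑ a, ∑ Q : PauliString n, ∑ b, pauliOp Q a b * A b a * pauliOp Q c d
      = ∑ a, ∑ b, A b a * ∑ Q : PauliString n, pauliOp Q a b * pauliOp Q c d := by
        refine Finset.sum_congr rfl fun a _ => ?_
        rw [Finset.sum_comm]
        refine Finset.sum_congr rfl fun b _ => ?_
        rw [Finset.mul_sum]
        exact Finset.sum_congr rfl fun Q _ => by ring
    _ = 2 ^ n * A c d := by
        simp only [pauliOp_completeness]
        rw [Finset.sum_eq_single d, Finset.sum_eq_single c]
        · simp [mul_comm]
        · intro b _ hb; simp [hb]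
        · simp
        · intro a _ ha; simp [ha]
        · simp

theorem exists_trace_pauliOp_mul_ne_zero {A : Op n} (hA : A ≠ 0) :
    ∃ K : PauliString n, (pauliOp K * A).trace ≠ 0 := by
  by_contra! h
  have := sum_trace_smul_pauliOp A
  simp only [h, zero_smul, Finset.sum_const_zero] at this
  exact hA ((smul_eq_zero.mp this.symm).resolve_left (by positivity))

/-! ### Rotations generated by Pauli strings -/

theorem exp_smul_involution {H : Op n} (hH : H * H = 1) (θ : ℝ) :
    NormedSpace.exp ((Complex.I * (θ : ℂ)) • H)
      = Complex.cos θ • (1 : Op n) + (Complex.I * Complex.sin θ) • H := by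
  -- Even powers of an involution are 1 and odd powers are H, so the exponential series splits into
  -- the cosine and sine series.
  have he : ∀ k, H ^ (2 * k) = 1 := fun k => by rw [pow_mul, pow_two, hH, one_pow]
  have ho : ∀ k, H ^ (2 * k + 1) = H := fun k => by rw [pow_succ, he, one_mul]
  rw [NormedSpace.exp_eq_tsum ℂ]
  refine HasSum.tsum_eq (HasSum.even_add_odd ?_ ?_)
  · convert! (Complex.hasSum_cos' (θ : ℂ)).smul_const (1 : Op n) using 2 with k
    rw [smul_pow, he, smul_smul, mul_comm Complex.I, div_eq_inv_mul]
  · convert! ((Complex.hasSum_sin' (θ : ℂ)).mul_left Complex.I).smul_const H using 2 with k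
    rw [smul_pow, ho, smul_smul, mul_comm Complex.I, mul_div_cancel₀ _ Complex.I_ne_zero,
      div_eq_inv_mul]

/-! ### Lower bounds on the trace norm and the diamond norm -/

/-- The easy half of the duality between trace norm and operator norm. In an eigenbasis of Aᴴ A,
column i of W A has norm equal to the i-th singular value, which dominates the i-th diagonal entry.
-/
theorem norm_trace_mul_le_traceNorm {ι : Type*} [Fintype ι] [DecidableEq ι]
    {W : Matrix ι ι ℂ} (hW : Wᴴ * W = 1) (A : Matrix ι ι ℂ) :
    ‖(W * A).trace‖ ≤ traceNorm A := by
  have hA := Matrix.isHermitian_conjTranspose_mul_self A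
  set V : Matrix ι ι ℂ := (hA.eigenvectorUnitary : Matrix ι ι ℂ) with hV
  have hV1 : V * Vᴴ = 1 := Unitary.coe_mul_star_self hA.eigenvectorUnitary
  have hdiag : Vᴴ * (Aᴴ * A) * V = Matrix.diagonal (RCLike.ofReal ∘ hA.eigenvalues) := by
    have := hA.conjStarAlgAut_star_eigenvectorUnitary
    rw [Unitary.conjStarAlgAut_apply] at this
    simpa [Matrix.star_eq_conjTranspose] using this
  set M : Matrix ι ι ℂ := Vᴴ * (W * A) * V with hM
  have hMM : Mᴴ * M = Matrix.diagonal (RCLike.ofReal ∘ hA.eigenvalues) := by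
    rw [← hdiag, hM]
    simp only [Matrix.conjTranspose_mul, Matrix.conjTranspose_conjTranspose]
    calc Vᴴ * (Aᴴ * Wᴴ * V) * (Vᴴ * (W * A) * V)
        = Vᴴ * Aᴴ * Wᴴ * (V * Vᴴ) * W * A * V := by simp only [Matrix.mul_assoc]
      _ = Vᴴ * Aᴴ * (Wᴴ * W) * A * V := by rw [hV1]; simp only [Matrix.mul_assoc, Matrix.one_mul]
      _ = _ := by rw [hW]; simp only [Matrix.mul_assoc, Matrix.one_mul]
  have htr : (W * A).trace = M.trace := by
    rw [hM, Matrix.trace_mul_comm (Vᴴ * (W * A)), ← Matrix.mul_assoc, hV1, Matrix.one_mul]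
  have hent : ∀ i, ‖M i i‖ ≤ √(hA.eigenvalues i) := fun i => by
    refine Real.le_sqrt_of_sq_le ?_
    have h1 : ((∑ j, ‖M j i‖ ^ 2 : ℝ) : ℂ) = (hA.eigenvalues i : ℂ) := by
      have h2 := congrFun (congrFun hMM i) i
      simp only [Matrix.mul_apply, Matrix.conjTranspose_apply, Matrix.diagonal_apply_eq] at h2
      rw [Function.comp_apply] at h2
      refine Eq.trans ?_ h2
      push_cast
      exact Finset.sum_congr rfl fun j _ => by
        rw [Complex.star_def, ← Complex.normSq_eq_conj_mul_self, Complex.normSq_eq_norm_sq]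
        push_cast; rfl
    rw [← Complex.ofReal_inj.mp h1]
    exact Finset.single_le_sum (f := fun j => ‖M j i‖ ^ 2) (fun j _ => by positivity)
      (Finset.mem_univ i)
  rw [htr, traceNorm, Matrix.trace]
  exact (norm_sum_le _ _).trans (Finset.sum_le_sum fun i _ => hent i)

/-- Testing `φ` on a state and a unitary observable, without ancilla, bounds its diamond norm. -/
theorem le_diamondNorm {ι : Type*} [Fintype ι] [DecidableEq ι]
    (φ : Matrix ι ι ℂ →ₗ[ℂ] Matrix ι ι ℂ) {ρ W : Matrix ι ι ℂ} (hρ : IsState ρ)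
    (hW : Wᴴ * W = 1) :
    ENNReal.ofReal ‖(W * φ ρ).trace‖ ≤ diamondNorm φ := by
  -- The trivial ancilla has dimension 1; dimension 0 would leave no states.
  let e : ι × Fin 1 ≃ ι := Equiv.prodUnique ι (Fin 1)
  have hst : IsState (ρ.submatrix e e) := by
    refine ⟨hρ.1.submatrix e, ?_⟩
    rw [← hρ.2, Matrix.trace, Matrix.trace]
    exact Equiv.sum_comp e fun i => ρ i i
  have hout : withAncilla φ 1 (ρ.submatrix e e) = (φ ρ).submatrix e e := rfl
  have hle := norm_trace_mul_le_traceNorm (W := W.submatrix e e)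
    (by rw [Matrix.conjTranspose_submatrix, Matrix.submatrix_mul_equiv, hW,
      Matrix.submatrix_one_equiv])
    (withAncilla φ 1 (ρ.submatrix e e))
  have htr : (W.submatrix e e * withAncilla φ 1 (ρ.submatrix e e)).trace = (W * φ ρ).trace := by
    rw [hout, Matrix.submatrix_mul_equiv, Matrix.trace, Matrix.trace]
    exact Equiv.sum_comp e fun i => (W * φ ρ) i i
  rw [htr] at hle
  refine (ENNReal.ofReal_le_ofReal hle).trans ?_
  exact le_iSup_of_le 1 (le_iSup_of_le (ρ.submatrix e e) (le_iSup_of_le hst le_rfl))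

/-! ### Pauli rotations in the Heisenberg picture and the light cone of a circuit -/

/-- The rotation `exp(i θ H)` about a Pauli string `H`. -/
noncomputable def pauliRot (θ : ℝ) (H : PauliString n) : Op n :=
  Complex.cos θ • (1 : Op n) + (Complex.I * Complex.sin θ) • pauliOp H

theorem exp_smul_pauliOp (θ : ℝ) (H : PauliString n) :
    NormedSpace.exp ((Complex.I * (θ : ℂ)) • pauliOp H) = pauliRot θ H :=
  exp_smul_involution (pauliOp_mul_self H) θ

theorem pauliRot_conjTranspose (θ : ℝ) (H : PauliString n) :
    (pauliRot θ H)ᴴ = Complex.cos θ • (1 : Op n) - (Complex.I * Complex.sin θ) • pauliOp H := by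
  rw [pauliRot, Matrix.conjTranspose_add, Matrix.conjTranspose_smul, Matrix.conjTranspose_smul,
    pauliOp_conjTranspose, Matrix.conjTranspose_one, sub_eq_add_neg, ← neg_smul]
  congr 2
  · simp [← Complex.cos_conj]
  · simp [← Complex.sin_conj]

theorem pauliRot_unitary (θ : ℝ) (H : PauliString n) :
    pauliRot θ H ∈ Matrix.unitaryGroup (Bits n) ℂ := by
  rw [Matrix.mem_unitaryGroup_iff', Matrix.star_eq_conjTranspose, pauliRot_conjTranspose, pauliRot]
  have h := Complex.cos_sq_add_sin_sq (θ : ℂ)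
  simp only [Matrix.sub_mul, Matrix.mul_add, Matrix.smul_mul, Matrix.mul_smul, Matrix.one_mul,
    Matrix.mul_one, pauliOp_mul_self]
  have h2 : Complex.cos θ * Complex.cos θ
      - (Complex.I * Complex.sin θ) * (Complex.I * Complex.sin θ) = 1 := by
    linear_combination h - Complex.sin θ ^ 2 * Complex.I_sq
  match_scalars
  · linear_combination h2
  · ring

/-- In the Heisenberg picture a rotation about `H` maps `Q` to a combination of `Q` and a
neighbour of `Q`. -/
theorem pauliRot_conj {S : Set (PauliString n)} {H : PauliString n} (hH : H ∈ S) (θ : ℝ)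
    (Q : PauliString n) :
    ∃ (R : PauliString n) (a b : ℂ), (b ≠ 0 → CommutatorAdj S Q R) ∧
      (pauliRot θ H)ᴴ * pauliOp Q * pauliRot θ H = a • pauliOp Q + b • pauliOp R := by
  obtain ⟨σ, hσ, hcomm⟩ := pauliOp_comm_or Q H
  obtain ⟨R, t, ht, hR⟩ := pauliOp_mul H Q
  have hHQH : pauliOp H * pauliOp Q * pauliOp H = σ • pauliOp Q := by
    rw [Matrix.mul_assoc, hcomm, Matrix.mul_smul, ← Matrix.mul_assoc, pauliOp_mul_self,
      Matrix.one_mul]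
  -- With H Q = t R and Q H = σ H Q, the cross terms of the conjugation add up to i cos θ sin θ (σ -
  -- 1) t R. They vanish if H and Q commute; otherwise [H, Q] = (1 - σ) t R gives an edge.
  refine ⟨R, Complex.cos θ * Complex.cos θ + σ * (Complex.sin θ * Complex.sin θ),
    Complex.I * Complex.cos θ * Complex.sin θ * ((σ - 1) * t), fun hb => ?_, ?_⟩
  · refine ⟨H, hH, (1 - σ) * t, fun h => hb ?_, ?_⟩
    · linear_combination (-Complex.I * Complex.cos θ * Complex.sin θ) * h
    · rw [hcomm, hR]; module
  · have hI : Complex.I * Complex.I = -1 := Complex.I_mul_I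
    rw [pauliRot_conjTranspose, pauliRot]
    simp only [Matrix.sub_mul, Matrix.mul_add, Matrix.smul_mul, Matrix.mul_smul, Matrix.one_mul,
      Matrix.mul_one, hHQH]
    rw [hcomm, hR]
    match_scalars
    · linear_combination (-σ * Complex.sin θ ^ 2) * hI
    · ring

/-- The rotation by `π / 4` about `H` exchanges the two ends of an edge of the commutator graph
labelled by `H`, up to sign. -/
theorem pauliRot_pi_div_four_conj {H Q R : PauliString n} {c : ℂ} (hc : c ≠ 0)
    (h : pauliOp H * pauliOp Q - pauliOp Q * pauliOp H = c • pauliOp R) :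
    ∃ z : ℂ, z * z = 1 ∧
      (pauliRot (Real.pi / 4) H)ᴴ * pauliOp Q * pauliRot (Real.pi / 4) H = z • pauliOp R := by
  obtain ⟨σ, hσ, hcomm⟩ := pauliOp_comm_or Q H
  have hσ1 : σ = -1 := by
    rcases mul_self_eq_one_iff.mp hσ with rfl | h1
    · rw [hcomm, one_smul, sub_self] at h
      have h0 : pauliOp R = 0 := (smul_eq_zero.mp h.symm).resolve_left hc
      have h1 := pauliOp_mul_self R
      rw [h0, Matrix.zero_mul] at h1
      exact absurd h1 zero_ne_one
    · exact h1
  subst hσ1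
  have hHQH : pauliOp H * pauliOp Q * pauliOp H = -pauliOp Q := by
    rw [Matrix.mul_assoc, hcomm, Matrix.mul_smul, ← Matrix.mul_assoc, pauliOp_mul_self,
      Matrix.one_mul, neg_one_smul]
  have hQH : pauliOp Q * pauliOp H = pauliOp H * pauliOp Q - c • pauliOp R := by
    rw [← h]; abel
  set V := pauliRot (Real.pi / 4) H with hV
  have hcs : Complex.cos ((Real.pi / 4 : ℝ) : ℂ) = Complex.sin ((Real.pi / 4 : ℝ) : ℂ) := by
    rw [← Complex.ofReal_cos, ← Complex.ofReal_sin, Real.cos_pi_div_four, Real.sin_pi_div_four]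
  have hz : Vᴴ * pauliOp Q * V =
      (-(Complex.I * Complex.sin ((Real.pi / 4 : ℝ) : ℂ) ^ 2 * c)) • pauliOp R := by
    rw [hV, pauliRot_conjTranspose, pauliRot, hcs]
    simp only [Matrix.sub_mul, Matrix.mul_add, Matrix.smul_mul, Matrix.mul_smul, Matrix.one_mul,
      Matrix.mul_one, hHQH]
    rw [hQH]
    generalize Complex.sin ((Real.pi / 4 : ℝ) : ℂ) = w
    match_scalars
    · linear_combination w ^ 2 * Complex.I_mul_I
    · ring
    · ring
  refine ⟨_, ?_, hz⟩
  have hVV : V * Vᴴ = 1 := Matrix.mem_unitaryGroup_iff.mp (pauliRot_unitary (Real.pi / 4) H)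
  have hVV' : Vᴴ * V = 1 := Matrix.mem_unitaryGroup_iff'.mp (pauliRot_unitary (Real.pi / 4) H)
  -- Conjugation by a unitary preserves Q² = 1, which forces the scalar to square to 1 without
  -- computing c.
  have h1 : (Vᴴ * pauliOp Q * V) * (Vᴴ * pauliOp Q * V) = 1 := by
    calc _ = Vᴴ * pauliOp Q * (V * Vᴴ) * pauliOp Q * V := by simp only [Matrix.mul_assoc]
      _ = Vᴴ * (pauliOp Q * pauliOp Q) * V := by
        rw [hVV]; simp only [Matrix.mul_assoc, Matrix.one_mul]
      _ = 1 := by rw [pauliOp_mul_self, Matrix.mul_one, hVV']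
  rw [hz, Matrix.smul_mul, Matrix.mul_smul, pauliOp_mul_self, smul_smul] at h1
  have h2 := congrFun (congrFun h1 0) 0
  simpa using h2

theorem isPauliCircuit_iff (S : Set (PauliString n)) (N : ℕ) (U : UGroup n) :
    IsPauliCircuit S N U ↔ ∃ (θ : Fin N → ℝ) (H : Fin N → PauliString n), (∀ l, H l ∈ S) ∧
      (U : Op n) = (List.ofFn fun l => pauliRot (θ l) (H l)).prod := by
  simp only [IsPauliCircuit, exp_smul_pauliOp]

/-- The light cone of a circuit: after `N` rotations, `P` has spread at most over the ball of
radius `N` in the commutator graph. -/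
theorem trace_circuit_eq_zero {S : Set (PauliString n)} {P : PauliString n} :
    ∀ {N : ℕ} (θ : Fin N → ℝ) {H : Fin N → PauliString n}, (∀ l, H l ∈ S) →
      ∀ {Q : PauliString n}, Q ∉ pauliBall S N P →
        (pauliOp Q * ((List.ofFn fun l => pauliRot (θ l) (H l)).prod * pauliOp P *
          ((List.ofFn fun l => pauliRot (θ l) (H l)).prod)ᴴ)).trace = 0
  | 0, θ, H, hH, Q, hQ => by
      have hPQ : Q ≠ P := by rintro rfl; exact hQ (by simp [pauliBall])
      simpa using pauliOp_trace_mul hPQ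
  | N + 1, θ, H, hH, Q, hQ => by
      have ih := fun {Q} => trace_circuit_eq_zero (P := P) (fun l : Fin N => θ l.succ)
        (fun l => hH l.succ) (Q := Q)
      rw [List.ofFn_succ, List.prod_cons]
      set U := (List.ofFn fun l : Fin N => pauliRot (θ l.succ) (H l.succ)).prod
      obtain ⟨R, a, b, hb, hV⟩ := pauliRot_conj (hH 0) (θ 0) Q
      set V := pauliRot (θ 0) (H 0)
      -- The head of the list is the last gate to act on P, so cyclicity of the trace moves it onto
      -- Q. The result involves only Q and a neighbour R, and both lie outside the ball of radius N
      -- when Q lies outside that of radius N + 1.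
      have hcyc : (pauliOp Q * (V * U * pauliOp P * (V * U)ᴴ)).trace
          = ((Vᴴ * pauliOp Q * V) * (U * pauliOp P * Uᴴ)).trace := by
        rw [Matrix.mul_assoc Vᴴ, Matrix.mul_assoc Vᴴ, Matrix.trace_mul_comm Vᴴ,
          Matrix.conjTranspose_mul]
        simp only [Matrix.mul_assoc]
      have hQ' : Q ∉ pauliBall S N P := fun h => hQ
        (le_trans (show (commutatorGraph S).edist P Q ≤ N from h) (by exact_mod_cast N.le_succ))
      rw [hcyc, hV, Matrix.add_mul, Matrix.smul_mul, Matrix.smul_mul, Matrix.trace_add,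
        Matrix.trace_smul, Matrix.trace_smul, ih hQ', smul_zero, zero_add]
      by_cases hb0 : b = 0
      · rw [hb0, zero_smul]
      · have hadj : (commutatorGraph S).Adj R Q := (hb hb0).symm
        rw [ih, smul_zero]
        intro hR
        refine hQ ?_
        calc (commutatorGraph S).edist P Q
            ≤ (commutatorGraph S).edist P R + (commutatorGraph S).edist R Q :=
              SimpleGraph.edist_triangle
          _ ≤ N + 1 := add_le_add hR (SimpleGraph.edist_eq_one_iff_adj.mpr hadj).le
          _ = ((N + 1 : ℕ) : ℕ∞) := by push_cast; rfl

/-! ### Invariant bilinear forms -/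

/-- The hypothesis amounts to K Hᵀ = -H K: moving the transposed rotation to the left of K turns it
into the inverse rotation. -/
theorem pauliRot_mul_mul_transpose {H : PauliString n} {K : Op n}
    (h : pauliOp H * K * (pauliOp H)ᵀ = -K) (θ : ℝ) :
    pauliRot θ H * K * (pauliRot θ H)ᵀ = K := by
  have h1 : K * (pauliOp H)ᵀ = -(pauliOp H * K) := by
    calc K * (pauliOp H)ᵀ = pauliOp H * (pauliOp H * K * (pauliOp H)ᵀ) := by
          rw [← Matrix.mul_assoc, ← Matrix.mul_assoc, pauliOp_mul_self, Matrix.one_mul]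
      _ = _ := by rw [h, Matrix.mul_neg]
  have hcs := Complex.cos_sq_add_sin_sq (θ : ℂ)
  rw [pauliRot]
  simp only [Matrix.transpose_add, Matrix.transpose_smul, Matrix.transpose_one, Matrix.add_mul,
    Matrix.mul_add, Matrix.smul_mul, Matrix.mul_smul, Matrix.one_mul, Matrix.mul_one, h, h1]
  match_scalars
  · linear_combination hcs - Complex.sin θ ^ 2 * Complex.I_mul_I
  · ring

/-- If a group of Pauli rotations preserves a bilinear form, then it fixes the operator of some
Pauli string under `K ↦ U K Uᵀ`. -/
theorem exists_pauliOp_invariant {G : Subgroup (UGroup n)} (hG : IsPauliCompatible G)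
    (hΩ : PreservesBilinearForm G) :
    ∃ K : PauliString n, ∀ U ∈ G, (U : Op n) * pauliOp K * (U : Op n)ᵀ = pauliOp K := by
  obtain ⟨⟨S₀, hS₀⟩, -⟩ := hG
  obtain ⟨Ω, hΩ0, hΩ⟩ := hΩ
  obtain ⟨K, hK⟩ := exists_trace_pauliOp_mul_ne_zero hΩ0
  have hgen : ∀ H ∈ S₀, pauliOp H * pauliOp K * (pauliOp H)ᵀ = -pauliOp K := by
    intro H hH
    obtain ⟨V, hV⟩ : ∃ V : UGroup n, (V : Op n) = pauliRot (Real.pi / 2) H :=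
      ⟨⟨_, pauliRot_unitary _ H⟩, rfl⟩
    have hmem : V ∈ G := (hS₀ _).mpr ⟨1, (isPauliCircuit_iff _ _ _).mpr
      ⟨fun _ => Real.pi / 2, fun _ => H, fun _ => hH, by simpa using hV⟩⟩
    have h1 := hΩ _ hmem
    have hrot : pauliRot (Real.pi / 2) H = Complex.I • pauliOp H := by
      simp [pauliRot]
    rw [hV, hrot, Matrix.transpose_smul, Matrix.smul_mul, Matrix.smul_mul, Matrix.mul_smul, smul_smul,
      Complex.I_mul_I, neg_one_smul] at h1
    obtain ⟨s, hs, hHT⟩ := pauliOp_transpose H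
    obtain ⟨σ, hσ, hHK⟩ := pauliOp_comm_or H K
    have hconj : pauliOp H * pauliOp K * (pauliOp H)ᵀ = (s * σ) • pauliOp K := by
      rw [hHT, hHK, Matrix.mul_smul, Matrix.smul_mul, Matrix.mul_assoc, pauliOp_mul_self,
        Matrix.mul_one, smul_smul]
    -- Pairing K with Hᵀ Ω H = -Ω determines the sign sσ, because tr(K Ω) ≠ 0.
    have h2 : (pauliOp K * Ω).trace = -((s * σ) * (pauliOp K * Ω).trace) := by
      calc (pauliOp K * Ω).trace = (pauliOp K * -((pauliOp H)ᵀ * Ω * pauliOp H)).trace := by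
            rw [h1]
        _ = -((pauliOp H * pauliOp K * (pauliOp H)ᵀ) * Ω).trace := by
            rw [Matrix.mul_neg, Matrix.trace_neg, Matrix.mul_assoc (pauliOp H),
              Matrix.mul_assoc (pauliOp H), Matrix.trace_mul_comm (pauliOp H)]
            simp only [Matrix.mul_assoc]
        _ = _ := by rw [hconj, Matrix.smul_mul, Matrix.trace_smul, smul_eq_mul]
    have h3 : s * σ = -1 := mul_right_cancel₀ hK (by linear_combination h2)
    rw [hconj, h3, neg_one_smul]
  refine ⟨K, fun U hU => ?_⟩
  obtain ⟨N, hN⟩ := (hS₀ U).mp hU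
  obtain ⟨θ, H, hH, hU'⟩ := (isPauliCircuit_iff _ _ _).mp hN
  rw [hU']
  have hlist : ∀ l : List (Op n), (∀ A ∈ l, A * pauliOp K * Aᵀ = pauliOp K) →
      l.prod * pauliOp K * l.prodᵀ = pauliOp K := by
    intro l
    induction l with
    | nil => intro; simp
    | cons A l ih =>
      intro h
      rw [List.prod_cons, Matrix.transpose_mul]
      calc A * l.prod * pauliOp K * (l.prodᵀ * Aᵀ)
          = A * (l.prod * pauliOp K * l.prodᵀ) * Aᵀ := by simp only [Matrix.mul_assoc]
        _ = pauliOp K := by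
          rw [ih fun B hB => h B (List.mem_cons_of_mem _ hB), h A List.mem_cons_self]
  refine hlist _ fun A hA => ?_
  obtain ⟨l, rfl⟩ := List.mem_ofFn.mp hA
  exact pauliRot_mul_mul_transpose (hgen _ (hH l)) _

theorem exists_mem_eq_pauliRot {G : Subgroup (UGroup n)} {H : PauliString n}
    (hH : Complex.I • pauliOp H ∈ lieAlgebra G) (θ : ℝ) :
    ∃ U ∈ G, (U : Op n) = pauliRot θ H := by
  obtain ⟨U, hU, h⟩ := hH θ
  exact ⟨U, hU, by rw [h, smul_smul, mul_comm, exp_smul_pauliOp]⟩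

/-- Places the circuits inside the group, so that the invariance of K applies to them as well. -/
theorem mem_of_isPauliCircuit {G : Subgroup (UGroup n)} {S : Set (PauliString n)}
    (hS : ∀ H ∈ S, Complex.I • pauliOp H ∈ lieAlgebra G) {N : ℕ} {U : UGroup n}
    (hU : IsPauliCircuit S N U) : U ∈ G := by
  obtain ⟨θ, H, hH, hU⟩ := (isPauliCircuit_iff _ _ _).mp hU
  choose V hV hV' using fun l => exists_mem_eq_pauliRot (hS _ (hH l)) (θ l)
  have : U = (List.ofFn V).prod := by
    apply Subtype.ext
    rw [hU, ← Submonoid.coe_subtype, map_list_prod, List.map_ofFn]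
    simp only [Function.comp_def, Submonoid.coe_subtype, hV']
  rw [this]
  exact Subgroup.list_prod_mem _ fun x hx => by
    obtain ⟨l, rfl⟩ := List.mem_ofFn.mp hx
    exact hV l

/-! ### The Bell basis twisted by an invariant Pauli string -/

/-- The vectorization of `Q K`, a vector of norm `√(2 ^ n)` in `(ℂ²)^{⊗ n} ⊗ (ℂ²)^{⊗ n}`. -/
noncomputable def bellVec (K Q : PauliString n) : Bits n × Bits n → ℂ :=
  (pauliOp Q * pauliOp K).vec

/-- The projection onto the line of `bellVec K Q`. -/
noncomputable def bellProj (K Q : PauliString n) :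
    Matrix (Bits n × Bits n) (Bits n × Bits n) ℂ :=
  ((2 : ℂ) ^ n)⁻¹ • Matrix.vecMulVec (bellVec K Q) (star (bellVec K Q))

/-- Inner products of vectorizations are Hilbert–Schmidt products, so overlaps in the twisted Bell
basis become Pauli coefficients of A K. -/
theorem star_bellVec_dotProduct_vec (K Q : PauliString n) (A : Op n) :
    star (bellVec K Q) ⬝ᵥ A.vec = (pauliOp Q * (A * pauliOp K)).trace := by
  rw [bellVec, Matrix.star_vec_dotProduct_vec, Matrix.conjTranspose_mul, pauliOp_conjTranspose,
    pauliOp_conjTranspose, Matrix.mul_assoc, Matrix.trace_mul_comm, Matrix.mul_assoc]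

theorem star_bellVec_dotProduct_bellVec (K Q R : PauliString n) :
    star (bellVec K Q) ⬝ᵥ bellVec K R = if Q = R then 2 ^ n else 0 := by
  rw [bellVec.eq_def K R, star_bellVec_dotProduct_vec, Matrix.mul_assoc, pauliOp_mul_self,
    Matrix.mul_one]
  split_ifs with h
  · rw [h, pauliOp_trace_mul_self]
  · exact pauliOp_trace_mul h

theorem bellProj_mul (K Q R : PauliString n) :
    bellProj K Q * bellProj K R = if Q = R then bellProj K Q else 0 := by
  rw [bellProj, bellProj, Matrix.smul_mul, Matrix.mul_smul, Matrix.vecMulVec_mul_vecMulVec,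
    star_bellVec_dotProduct_bellVec]
  split_ifs with h
  · subst h
    rw [Matrix.vecMulVec_smul, smul_smul, smul_smul, mul_assoc, inv_mul_cancel₀ (by positivity),
      mul_one]
  · simp

theorem bellProj_conjTranspose (K Q : PauliString n) : (bellProj K Q)ᴴ = bellProj K Q := by
  rw [bellProj, Matrix.conjTranspose_smul, Matrix.conjTranspose_vecMulVec, star_star]
  simp

/-- Every vector is vec A for some A, and resolving it in the twisted Bell basis is the Pauli
expansion of A K, multiplied back by K. -/
theorem sum_bellProj (K : PauliString n) : ∑ Q, bellProj K Q = 1 := by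
  refine Matrix.ext_of_mulVec_single fun x => ?_
  generalize (Pi.single x 1 : Bits n × Bits n → ℂ) = v
  -- The indices are swapped because `vec` stacks columns.
  obtain ⟨A, rfl⟩ : ∃ A : Op n, v = A.vec := ⟨Matrix.of fun i j => v (j, i), rfl⟩
  rw [Matrix.one_mulVec, Matrix.sum_mulVec]
  have h : ∀ Q, bellProj K Q *ᵥ A.vec
      = (((2 : ℂ) ^ n)⁻¹ • (((pauliOp Q * (A * pauliOp K)).trace • pauliOp Q) * pauliOp K)).vec := by
    intro Q
    rw [bellProj, Matrix.smul_mulVec, Matrix.vecMulVec_mulVec, star_bellVec_dotProduct_vec,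
      bellVec, Matrix.vec_smul, Matrix.smul_mul, Matrix.vec_smul]
    simp
  simp only [h]
  rw [← Matrix.vec_sum, ← Finset.smul_sum, ← Matrix.sum_mul, sum_trace_smul_pauliOp,
    Matrix.smul_mul, smul_smul, inv_mul_cancel₀ (by positivity), one_smul, Matrix.mul_assoc,
    pauliOp_mul_self, Matrix.mul_one]

theorem isState_bellProj (K Q : PauliString n) : IsState (bellProj K Q) := by
  refine ⟨(Matrix.posSemidef_vecMulVec_self_star _).smul ?_, ?_⟩
  · have : ((2 : ℂ) ^ n)⁻¹ = (((2 : ℝ) ^ n)⁻¹ : ℝ) := by push_cast; rfl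
    rw [this]
    exact Complex.zero_le_real.mpr (by positivity)
  · rw [bellProj, Matrix.trace_smul, Matrix.trace_vecMulVec, dotProduct_comm,
      star_bellVec_dotProduct_bellVec, if_pos rfl, smul_eq_mul, inv_mul_cancel₀ (by positivity)]

/-- The reflection `2 Π - 1`, where `Π` projects onto the span of the vectors indexed by `s`. -/
noncomputable def bellReflection (K : PauliString n) (s : Finset (PauliString n)) :
    Matrix (Bits n × Bits n) (Bits n × Bits n) ℂ :=
  (2 : ℂ) • ∑ Q ∈ s, bellProj K Q - 1

theorem bellReflection_unitary (K : PauliString n) (s : Finset (PauliString n)) :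
    (bellReflection K s)ᴴ * bellReflection K s = 1 := by
  have hself : (∑ Q ∈ s, bellProj K Q)ᴴ = ∑ Q ∈ s, bellProj K Q := by
    rw [Matrix.conjTranspose_sum]
    exact Finset.sum_congr rfl fun Q _ => bellProj_conjTranspose K Q
  have hidem : (∑ Q ∈ s, bellProj K Q) * (∑ Q ∈ s, bellProj K Q) = ∑ Q ∈ s, bellProj K Q := by
    rw [Finset.sum_mul_sum]
    refine Finset.sum_congr rfl fun Q hQ => ?_
    simp only [bellProj_mul]
    rw [Finset.sum_ite_eq, if_pos hQ]
  have hstar : (bellReflection K s)ᴴ = bellReflection K s := by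
    rw [bellReflection, Matrix.conjTranspose_sub, Matrix.conjTranspose_smul, hself,
      Matrix.conjTranspose_one]
    simp
  rw [hstar, bellReflection, Matrix.sub_mul, Matrix.mul_sub, Matrix.smul_mul, Matrix.mul_smul,
    hidem, Matrix.mul_one, Matrix.one_mul]
  module

/-! ### Transition probabilities -/

theorem trace_mul_momentChannel (ν : Measure (UGroup n)) [IsFiniteMeasure ν]
    (A X : Matrix (Bits n × Bits n) (Bits n × Bits n) ℂ) :
    (A * momentChannel ν X).trace = ∫ U : UGroup n,
      (A * (((U : Op n) ⊗ₖ (U : Op n)) * X * ((U : Op n) ⊗ₖ (U : Op n))ᴴ)).trace ∂ν := by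
  have key : ∀ B, (A * B).trace = ∑ a, ∑ b, A a b * B b a := fun _ => rfl
  simp only [key]
  refine ((integral_finsetSum _ fun a _ => integrable_finsetSum _ fun b _ =>
    (integrable_twirl ν X b a).const_mul (A a b)).trans ?_).symm
  exact Finset.sum_congr rfl fun a _ => (integral_finsetSum _ fun b _ =>
    (integrable_twirl ν X b a).const_mul (A a b)).trans
      (Finset.sum_congr rfl fun b _ => integral_const_mul _ _)

theorem continuous_trace_mul_twirl (A X : Matrix (Bits n × Bits n) (Bits n × Bits n) ℂ) :
    Continuous fun U : UGroup n =>
      (A * (((U : Op n) ⊗ₖ (U : Op n)) * X * ((U : Op n) ⊗ₖ (U : Op n))ᴴ)).trace := by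
  have key : ∀ B, (A * B).trace = ∑ a, ∑ b, A a b * B b a := fun _ => rfl
  simp only [key]
  exact continuous_finsetSum _ fun a _ => continuous_finsetSum _ fun b _ =>
    continuous_const.mul (continuous_twirl X b a)

theorem trace_momentChannel (ν : Measure (UGroup n)) [IsProbabilityMeasure ν]
    (X : Matrix (Bits n × Bits n) (Bits n × Bits n) ℂ) :
    (momentChannel ν X).trace = X.trace := by
  rw [← Matrix.one_mul (momentChannel ν X), trace_mul_momentChannel]
  have h : ∀ U : UGroup n, (1 * (((U : Op n) ⊗ₖ (U : Op n)) * X *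
      ((U : Op n) ⊗ₖ (U : Op n))ᴴ)).trace = X.trace := fun U => by
    have hU : (U : Op n)ᴴ * (U : Op n) = 1 := Matrix.mem_unitaryGroup_iff'.mp U.2
    rw [Matrix.one_mul, Matrix.trace_mul_comm, ← Matrix.mul_assoc,
      Matrix.conjTranspose_kronecker, ← Matrix.mul_kronecker_mul, hU, Matrix.one_kronecker_one,
      Matrix.one_mul]
  simp only [h, integral_const, probReal_univ, one_smul]

/-- The squared modulus of the component of `U P U†` along the Pauli string `Q`. -/
noncomputable def pauliWeight (P Q : PauliString n) (U : Op n) : ℝ :=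
  ‖((2 : ℂ) ^ n)⁻¹ * (pauliOp Q * (U * pauliOp P * Uᴴ)).trace‖ ^ 2

/-- The point where the bilinear form enters: inserting U† U after P gives U P K Uᵀ = (U P U†)(U K
Uᵀ) = U P U† K. Thus U ⊗ U acts on the labels P by conjugation, and the trace is a Born probability.
-/
theorem trace_bellProj_mul_twirl {K : PauliString n} {U : UGroup n}
    (hU : (U : Op n) * pauliOp K * (U : Op n)ᵀ = pauliOp K) (P Q : PauliString n) :
    (bellProj K Q * (((U : Op n) ⊗ₖ (U : Op n)) * bellProj K P *
      ((U : Op n) ⊗ₖ (U : Op n))ᴴ)).trace = (pauliWeight P Q (U : Op n) : ℂ) := by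
  have hUU : (U : Op n)ᴴ * (U : Op n) = 1 := Matrix.mem_unitaryGroup_iff'.mp U.2
  have hvec : ((U : Op n) ⊗ₖ (U : Op n)) *ᵥ bellVec K P
      = ((U : Op n) * pauliOp P * (U : Op n)ᴴ * pauliOp K).vec := by
    rw [bellVec, Matrix.kronecker_mulVec_vec]
    congr 1
    calc (U : Op n) * (pauliOp P * pauliOp K) * (U : Op n)ᵀ
        = (U : Op n) * pauliOp P * ((U : Op n)ᴴ * (U : Op n)) * pauliOp K * (U : Op n)ᵀ := by
          rw [hUU]; simp only [Matrix.mul_assoc, Matrix.one_mul]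
      _ = (U : Op n) * pauliOp P * (U : Op n)ᴴ * ((U : Op n) * pauliOp K * (U : Op n)ᵀ) := by
          simp only [Matrix.mul_assoc]
      _ = _ := by rw [hU]
  have hM : ∀ M : Matrix (Bits n × Bits n) (Bits n × Bits n) ℂ, M * bellProj K P * Mᴴ
      = ((2 : ℂ) ^ n)⁻¹ • Matrix.vecMulVec (M *ᵥ bellVec K P) (star (M *ᵥ bellVec K P)) := fun M => by
    rw [bellProj, Matrix.mul_smul, Matrix.smul_mul, Matrix.mul_vecMulVec, Matrix.vecMulVec_mul,
      Matrix.star_mulVec]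
  rw [hM, bellProj, Matrix.smul_mul, Matrix.mul_smul,
    Matrix.vecMulVec_mul_vecMulVec, Matrix.trace_smul, Matrix.trace_smul, Matrix.trace_vecMulVec,
    dotProduct_smul]
  have h1 : star (bellVec K Q) ⬝ᵥ (((U : Op n) ⊗ₖ (U : Op n)) *ᵥ bellVec K P)
      = (pauliOp Q * ((U : Op n) * pauliOp P * (U : Op n)ᴴ)).trace := by
    rw [hvec, star_bellVec_dotProduct_vec, Matrix.mul_assoc _ (pauliOp K), pauliOp_mul_self,
      Matrix.mul_one]
  have h2 : bellVec K Q ⬝ᵥ star (((U : Op n) ⊗ₖ (U : Op n)) *ᵥ bellVec K P)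
      = star (pauliOp Q * ((U : Op n) * pauliOp P * (U : Op n)ᴴ)).trace := by
    rw [← h1, ← Matrix.star_dotProduct, dotProduct_comm]
  rw [h1, h2, pauliWeight, ← Complex.normSq_eq_norm_sq, Complex.normSq_eq_conj_mul_self]
  simp only [smul_eq_mul, map_mul, map_inv₀, map_pow, Complex.star_def, Complex.conj_ofNat]
  ring

theorem pauliWeight_nonneg (P Q : PauliString n) (U : Op n) : 0 ≤ pauliWeight P Q U := by
  unfold pauliWeight
  positivity

theorem pauliWeight_eq_zero {S : Set (PauliString n)} {N : ℕ} {U : UGroup n}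
    (hU : IsPauliCircuit S N U) {P Q : PauliString n} (hQ : Q ∉ pauliBall S N P) :
    pauliWeight P Q (U : Op n) = 0 := by
  obtain ⟨θ, H, hH, hU⟩ := (isPauliCircuit_iff _ _ _).mp hU
  rw [pauliWeight, hU, trace_circuit_eq_zero θ hH hQ]
  simp

/-- An edge of the graph becomes a left translation in the group exchanging the weights at its ends;
invariance of the Haar measure then makes the averaged weights equal. The sign from the π/4 rotation
disappears in the modulus. -/
theorem exists_mem_pauliWeight_mul {G : Subgroup (UGroup n)} {S : Set (PauliString n)}
    (hS : ∀ H ∈ S, Complex.I • pauliOp H ∈ lieAlgebra G) {Q R : PauliString n}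
    (h : CommutatorAdj S Q R) :
    ∃ V ∈ G, ∀ (P : PauliString n) (U : Op n),
      pauliWeight P Q ((V : Op n) * U) = pauliWeight P R U := by
  obtain ⟨H, hH, c, hc, h⟩ := h
  obtain ⟨V, hV, hV'⟩ := exists_mem_eq_pauliRot (hS H hH) (Real.pi / 4)
  obtain ⟨z, hz, hconj⟩ := pauliRot_pi_div_four_conj hc h
  have hz1 : ‖z‖ = 1 := by rcases mul_self_eq_one_iff.mp hz with rfl | rfl <;> simp
  refine ⟨V, hV, fun P U => ?_⟩
  rw [← hV'] at hconj
  have hcyc : (pauliOp Q * ((V : Op n) * U * pauliOp P * ((V : Op n) * U)ᴴ)).trace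
      = z * (pauliOp R * (U * pauliOp P * Uᴴ)).trace := by
    calc _ = (((V : Op n)ᴴ * pauliOp Q * (V : Op n)) * (U * pauliOp P * Uᴴ)).trace := by
          rw [Matrix.mul_assoc (V : Op n)ᴴ, Matrix.mul_assoc (V : Op n)ᴴ,
            Matrix.trace_mul_comm (V : Op n)ᴴ, Matrix.conjTranspose_mul]
          simp only [Matrix.mul_assoc]
      _ = _ := by rw [hconj, Matrix.smul_mul, Matrix.trace_smul, smul_eq_mul]
  rw [pauliWeight, pauliWeight, hcyc]
  simp only [norm_mul, hz1, one_mul]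

/-! ### Expectation of the reflection for circuits and for the Haar measure -/

theorem pauliBall_subset_pauliComponent (S : Set (PauliString n)) (N : ℕ) (P : PauliString n) :
    pauliBall S N P ⊆ pauliComponent S P := fun Q hQ =>
  SimpleGraph.edist_ne_top_iff_reachable.mp
    (ne_top_of_le_ne_top (ENat.natCast_ne_top N) (show (commutatorGraph S).edist P Q ≤ N from hQ))

theorem trace_bellReflection_mul (K : PauliString n) (s : Finset (PauliString n))
    (X : Matrix (Bits n × Bits n) (Bits n × Bits n) ℂ) :
    (bellReflection K s * X).trace = 2 * ∑ Q ∈ s, (bellProj K Q * X).trace - X.trace := by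
  rw [bellReflection, Matrix.sub_mul, Matrix.smul_mul, Matrix.one_mul, Matrix.trace_sub,
    Matrix.trace_smul, Matrix.sum_mul, Matrix.trace_sum, smul_eq_mul]

theorem sum_trace_bellProj_mul (K : PauliString n)
    (X : Matrix (Bits n × Bits n) (Bits n × Bits n) ℂ) :
    ∑ Q, (bellProj K Q * X).trace = X.trace := by
  rw [← Matrix.trace_sum, ← Matrix.sum_mul, sum_bellProj, Matrix.one_mul]

/-- Circuits keep all the weight inside the ball. -/
theorem trace_bellReflection_momentChannel_circuit {S : Set (PauliString n)} {N : ℕ}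
    {ν : Measure (UGroup n)} [IsProbabilityMeasure ν] (hν : ∀ᵐ U ∂ν, IsPauliCircuit S N U)
    {K : PauliString n}
    (hK : ∀ U, IsPauliCircuit S N U → (U : Op n) * pauliOp K * (U : Op n)ᵀ = pauliOp K)
    (P : PauliString n) {s : Finset (PauliString n)} (hs : ∀ Q, Q ∈ s ↔ Q ∈ pauliBall S N P) :
    (bellReflection K s * momentChannel ν (bellProj K P)).trace = 1 := by
  -- Outcomes outside the ball have probability zero for almost every U, so the probabilities inside
  -- it sum to 1 and the expectation is 2 · 1 - 1.
  have hzero : ∀ Q, Q ∉ s → (bellProj K Q * momentChannel ν (bellProj K P)).trace = 0 := by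
    intro Q hQ
    rw [trace_mul_momentChannel]
    refine integral_eq_zero_of_ae ?_
    filter_upwards [hν] with U hU
    rw [trace_bellProj_mul_twirl (hK U hU), pauliWeight_eq_zero hU (mt (hs Q).mpr hQ)]
    simp
  have hsum := sum_trace_bellProj_mul K (momentChannel ν (bellProj K P))
  rw [← Finset.sum_subset (Finset.subset_univ s) fun Q _ hQ => hzero Q hQ] at hsum
  rw [trace_bellReflection_mul, hsum, trace_momentChannel, (isState_bellProj K P).2]
  norm_num

/-- The Haar average spreads the weight uniformly over each connected component. -/
theorem trace_bellReflection_momentChannel_haar {G : Subgroup (UGroup n)} (μ : Measure G)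
    [μ.IsHaarMeasure] [IsProbabilityMeasure μ] {S : Set (PauliString n)}
    (hS : ∀ H ∈ S, Complex.I • pauliOp H ∈ lieAlgebra G) {K : PauliString n}
    (hK : ∀ U ∈ G, (U : Op n) * pauliOp K * (U : Op n)ᵀ = pauliOp K)
    (P : PauliString n) {s : Finset (PauliString n)} (hs : ∀ Q ∈ s, Q ∈ pauliComponent S P) :
    ∃ r : ℝ, r ≤ 2 * (s.card : ℝ) / ((pauliComponent S P).ncard : ℝ) - 1 ∧
      (bellReflection K s * momentChannel (μ.map Subtype.val) (bellProj K P)).trace = r := by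
  have hprob : IsProbabilityMeasure (μ.map (Subtype.val : G → UGroup n)) :=
    Measure.isProbabilityMeasure_map measurable_subtype_coe.aemeasurable
  let w : PauliString n → ℝ := fun Q => ∫ U : G, pauliWeight P Q ((U : UGroup n) : Op n) ∂μ
  have hw : ∀ Q, (bellProj K Q * momentChannel (μ.map Subtype.val) (bellProj K P)).trace = w Q := by
    intro Q
    rw [trace_mul_momentChannel, integral_map measurable_subtype_coe.aemeasurable
      (continuous_trace_mul_twirl _ _).aestronglyMeasurable]
    simp only [w]
    rw [← integral_complex_ofReal]
    exact integral_congr_ae (.of_forall fun U => trace_bellProj_mul_twirl (hK _ U.2) P Q)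
  have hw0 : ∀ Q, 0 ≤ w Q := fun Q => integral_nonneg fun U => pauliWeight_nonneg _ _ _
  have hsum : ∑ Q, w Q = 1 := by
    have h := sum_trace_bellProj_mul K (momentChannel (μ.map Subtype.val) (bellProj K P))
    simp only [hw] at h
    rw [trace_momentChannel, (isState_bellProj K P).2] at h
    exact_mod_cast h
  have hadj : ∀ Q R, CommutatorAdj S Q R → w Q = w R := by
    intro Q R h
    obtain ⟨V, hV, hVw⟩ := exists_mem_pauliWeight_mul hS h
    -- Haar invariance under the rotation attached to the edge.
    have h1 := integral_mul_left_eq_self (μ := μ)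
      (fun U : G => pauliWeight P Q ((U : UGroup n) : Op n)) ⟨V, hV⟩
    simp only [w]
    rw [← h1]
    exact integral_congr_ae (.of_forall fun U => hVw P _)
  have hcomp : ∀ Q ∈ pauliComponent S P, w Q = w P := by
    have hreach : ∀ A B, (commutatorGraph S).Reachable A B → w B = w A := by
      rintro A B ⟨p⟩
      induction p with
      | nil => rfl
      | cons h p ih => exact ih.trans (hadj _ _ h).symm
    exact fun Q hQ => hreach P Q hQ
  have hfin := Set.toFinite (pauliComponent S P)
  -- The equal weights on the component are part of a family of nonnegative weights with total 1.
  have hcard : ((pauliComponent S P).ncard : ℝ) * w P ≤ 1 := by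
    rw [Set.ncard_eq_toFinset_card _ hfin, ← nsmul_eq_mul, ← Finset.sum_const, ← hsum]
    rw [Finset.sum_congr rfl fun Q hQ => (hcomp Q (hfin.mem_toFinset.mp hQ)).symm]
    exact Finset.sum_le_sum_of_subset_of_nonneg (Finset.subset_univ _) fun Q _ _ => hw0 Q
  have hpos : 0 < ((pauliComponent S P).ncard : ℝ) := by
    exact_mod_cast (Set.ncard_pos hfin).mpr ⟨P, SimpleGraph.Reachable.refl P⟩
  refine ⟨2 * (s.card * w P) - 1, ?_, ?_⟩
  · have h1 : w P ≤ 1 / ((pauliComponent S P).ncard : ℝ) := by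
      rw [le_div_iff₀ hpos, mul_comm]; exact hcard
    have h2 : (s.card : ℝ) * w P ≤ s.card * (1 / ((pauliComponent S P).ncard : ℝ)) :=
      mul_le_mul_of_nonneg_left h1 (Nat.cast_nonneg _)
    rw [mul_one_div] at h2
    rw [mul_div_assoc]
    linarith
  · rw [trace_bellReflection_mul, trace_momentChannel, (isState_bellProj K P).2,
      Finset.sum_congr rfl fun Q hQ => (hw Q).trans (congrArg _ (hcomp Q (hs Q hQ))),
      Finset.sum_const]
    push_cast
    simp

end PauliDesign

theorem theorem2 (n : ℕ) (G : Subgroup (UGroup n))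
    (hG : IsPauliCompatible G) (hΩ : PreservesBilinearForm G)
    (μ : Measure G) [μ.IsHaarMeasure] [IsProbabilityMeasure μ]
    (S : Set (PauliString n)) (hS : ∀ H ∈ S, Complex.I • pauliOp H ∈ lieAlgebra G)
    (N : ℕ) (ν : Measure (UGroup n)) [IsProbabilityMeasure ν]
    (hν : ∀ᵐ U ∂ν, IsPauliCircuit S N U)
    (P : PauliString n) :
    ENNReal.ofReal (2 - 2 * ((pauliBall S N P).ncard : ℝ) / ((pauliComponent S P).ncard : ℝ)) ≤
      diamondNorm (momentChannel ν - momentChannel (μ.map Subtype.val)) := by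
  obtain ⟨K, hK⟩ := exists_pauliOp_invariant hG hΩ
  have hfin := Set.toFinite (pauliBall S N P)
  have hmem : ∀ Q, Q ∈ hfin.toFinset ↔ Q ∈ pauliBall S N P := fun Q => hfin.mem_toFinset
  have h1 := trace_bellReflection_momentChannel_circuit hν
    (fun U hU => hK U (mem_of_isPauliCircuit hS hU)) P hmem
  obtain ⟨r, hr, h2⟩ := trace_bellReflection_momentChannel_haar μ hS hK P (s := hfin.toFinset)
    fun Q hQ => pauliBall_subset_pauliComponent S N P ((hmem Q).mp hQ)
  rw [← Set.ncard_eq_toFinset_card _ hfin] at hr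
  -- The test state is the twisted Bell state of P, the test observable the reflection about the
  -- ball; the two expectations differ by 1 - r.
  refine le_trans (ENNReal.ofReal_le_ofReal ?_) (le_diamondNorm _ (isState_bellProj K P)
    (bellReflection_unitary K hfin.toFinset))
  rw [LinearMap.sub_apply, Matrix.mul_sub, Matrix.trace_sub, h1, h2]
  have h3 : (1 : ℂ) - (r : ℂ) = ((1 - r : ℝ) : ℂ) := by push_cast; rfl
  rw [h3, Complex.norm_real]
  refine le_trans ?_ (le_abs_self _)
  linarith
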